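/- A unary semigroup is a semigroup with an additional unary operation (subject to no law). A graph $\mathsf G=\langle V;\sim\rangle$ is a (possibly empty) set $V$ with an arbitrary binary relation $\sim$ on it (so graphs are directed and loops are allowed). Its adjacency semigroup $\mathrm A(\mathsf G)$ is the unary semigroup on $(V\times V)\cup\{0\}$ with $(x,y)(z,t)=(x,t)$ if $y\sim z$, $(x,y)(z,t)=0$ if $y\not\sim z$, $a0=0a=0$, $(x,y)'=(y,x)$, $0'=0$. Let $\mathscr A$, $\mathscr A_{\mathrm{symm}}$ and $\mathscr A_{\mathrm{ref}}$ be the varieties $\mathbb{HSP}(\cdot)$ of unary semigroups generated by the adjacency semigroups of all graphs, of all symmetric graphs, and of all reflexive graphs, respectively. Let $\mathsf G_1$ be the graph on $\{0,1,2,3\}$ with loops at $1,2,3$, with edges in both directions between $0$ and $1$, between $1$ and $3$, and between $2$ and $3$, with the one-way edge $1\sim 2$, and with no other edges. Let $\mathsf S_1$ be the graph on $\{0,1,2,3\}$ with loops at $1,2,3$, with edges in both directions between $0$ and $1$, between $1$ and $2$, and between $2$ and $3$, and with no other edges. Let $\mathsf R_1$ be the graph on $\{0,1,2\}$ with loops at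 all three vertices, with edges in both directions between $0$ and $2$ and between $1$ and $2$, with the one-way edge $0\sim 1$, and with no other edges. Then $\mathscr A=\mathbb{HSP}(\mathrm A(\mathsf G_1))$, $\mathscr A_{\mathrm{symm}}=\mathbb{HSP}(\mathrm A(\mathsf S_1))$ and $\mathscr A_{\mathrm{ref}}=\mathbb{HSP}(\mathrm A(\mathsf R_1))$; that is, the three varieties are generated by the finite adjacency semigroups $\mathrm A(\mathsf G_1)$, $\mathrm A(\mathsf S_1)$ and $\mathrm A(\mathsf R_1)$, which have $17$, $17$ and $10$ elements, respectively. -/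

import Mathlib

universe u v

namespace AdjSemigroup

/-! ### Unary semigroups and the class operators -/

/-- A unary semigroup: a semigroup with an additional unary operation `rev` (`a ↦ a'`), which is
not required to satisfy any law. -/
class UnarySemigroup (S : Type u) extends Semigroup S where
  rev : S → S

/-- Homomorphisms of unary semigroups. -/
structure IsUnaryHom {S : Type u} {T : Type v} [UnarySemigroup S] [UnarySemigroup T]
    (f : S → T) : Prop where
  map_mul : ∀ x y, f (x * y) = f x * f y
  map_rev : ∀ x, f (UnarySemigroup.rev x) = UnarySemigroup.rev (f x)

/-- Bundled unary semigroups. As usual for algebras, the underlying set is nonempty. -/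
structure USgrp where
  carrier : Type u
  [inst : UnarySemigroup carrier]
  [nonempty : Nonempty carrier]

attribute [instance] USgrp.inst USgrp.nonempty

/-- The direct product of unary semigroups, with coordinatewise operations. -/
instance piUnarySemigroup {ι : Type v} (S : ι → Type u) [∀ i, UnarySemigroup (S i)] :
    UnarySemigroup (∀ i, S i) where
  rev a := fun i => UnarySemigroup.rev (a i)

/-- The bundled direct product of a (possibly empty) family of unary semigroups. -/
def USgrp.pi {ι : Type v} (S : ι → USgrp.{u}) : USgrp.{max u v} where
  carrier := ∀ i, (S i).carrier

/-- The class of all homomorphic images of members of `K`. -/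
def opH (K : Set USgrp.{u}) : Set USgrp.{u} :=
  {T | ∃ S ∈ K, ∃ f : S.carrier → T.carrier, IsUnaryHom f ∧ Function.Surjective f}

/-- The class of all (isomorphic copies of) subalgebras of members of `K`. -/
def opS (K : Set USgrp.{u}) : Set USgrp.{u} :=
  {T | ∃ S ∈ K, ∃ f : T.carrier → S.carrier, IsUnaryHom f ∧ Function.Injective f}

/-- The class of all (isomorphic copies of) direct products of set-indexed families of members
of `K`, the empty product (the one-element algebra) included. -/
def opP (K : Set USgrp.{u}) : Set USgrp.{max u v} :=
  {T | ∃ (ι : Type v) (S : ι → USgrp.{u}), (∀ i, S i ∈ K) ∧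
    ∃ f : T.carrier → (USgrp.pi S).carrier, IsUnaryHom f ∧ Function.Bijective f}

/-- The variety of unary semigroups generated by the class `K`. The second universe is that of
the index sets of the direct products, so that finite generators may stay in `Type 0`. -/
def HSP (K : Set USgrp.{u}) : Set USgrp.{max u v} :=
  opH (opS (opP.{u, v} K))

/-! ### Adjacency semigroups

A graph is a set with an arbitrary binary relation, loops allowed; this is Mathlib's `Digraph`. -/

/-- The underlying set `(V × V) ∪ {0}` of the adjacency semigroup of `G`. -/
inductive Carrier {V : Type u} (G : Digraph V) : Type u
  | zero : Carrier G
  | pair (x y : V) : Carrier G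

namespace Carrier

variable {V : Type u} {G : Digraph V}

open Classical in
/-- `(x, y)(z, t)` is `(x, t)` if `y ∼ z` and `0` otherwise; all products with `0` are `0`. -/
noncomputable def mul : Carrier G → Carrier G → Carrier G
  | pair x y, pair z t => if G.Adj y z then pair x t else zero
  | _, _ => zero

/-- Reversion: `(x, y)' = (y, x)` and `0' = 0`. -/
def rev : Carrier G → Carrier G
  | pair x y => pair y x
  | zero => zero

theorem mul_assoc' (a b c : Carrier G) : mul (mul a b) c = mul a (mul b c) := by
  cases a <;> cases b <;> cases c <;> simp only [mul]
  all_goals (try split_ifs) <;> simp_all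

noncomputable instance : UnarySemigroup (Carrier G) where
  mul := mul
  mul_assoc := mul_assoc'
  rev := rev

instance : Nonempty (Carrier G) := ⟨zero⟩

end Carrier

/-- The adjacency semigroup `A(G)` of a graph `G`, as a unary semigroup. -/
noncomputable def A {V : Type u} (G : Digraph V) : USgrp.{u} where
  carrier := Carrier G

/-! ### The varieties -/

/-- The variety generated by the adjacency semigroups of all graphs. -/
def varA : Set USgrp.{u} :=
  HSP.{u, u} {S | ∃ (V : Type u) (G : Digraph V), S = A G}

/-- The variety generated by the adjacency semigroups of all symmetric graphs. -/
def varAsymm : Set USgrp.{u} :=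
  HSP.{u, u} {S | ∃ (V : Type u) (G : Digraph V),
    (∀ x y, G.Adj x y → G.Adj y x) ∧ S = A G}

/-- The variety generated by the adjacency semigroups of all reflexive graphs. -/
def varAref : Set USgrp.{u} :=
  HSP.{u, u} {S | ∃ (V : Type u) (G : Digraph V), (∀ x, G.Adj x x) ∧ S = A G}

/-! ### The three finite graphs -/

/-- Vertices `0, 1, 2, 3`; loops at `1, 2, 3`; undirected edges `01`, `13`, `23`;
a one-way edge from `1` to `2`. -/
def G₁ : Digraph (Fin 4) where
  Adj x y := (x, y) ∈ ({(1, 1), (2, 2), (3, 3), (0, 1), (1, 0), (1, 3), (3, 1), (2, 3), (3, 2),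
    (1, 2)} : Finset (Fin 4 × Fin 4))

/-- Vertices `0, 1, 2, 3`; loops at `1, 2, 3`; undirected edges `01`, `12`, `23`. -/
def S₁ : Digraph (Fin 4) where
  Adj x y := (x, y) ∈ ({(1, 1), (2, 2), (3, 3), (0, 1), (1, 0), (1, 2), (2, 1), (2, 3), (3, 2)} :
    Finset (Fin 4 × Fin 4))

/-- Vertices `0, 1, 2`; loops at all vertices; undirected edges `02`, `12`; a one-way edge from
`0` to `1`. -/
def R₁ : Digraph (Fin 3) where
  Adj x y := (x, y) ∈ ({(0, 0), (1, 1), (2, 2), (0, 2), (2, 0), (1, 2), (2, 1), (0, 1)} :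
    Finset (Fin 3 × Fin 3))

end AdjSemigroup

/-!
The tuples with a zero coordinate form an ideal of a product of adjacency semigroups, and the Rees
quotient by this ideal is the adjacency semigroup of the product digraph. Since an induced subgraph
gives a subalgebra, `A(G)` lies in `HSP(A(H))` as soon as the homomorphisms from `G` to `H` separate
the vertices and the non-edges of `G`.

For the three finite graphs, the required homomorphisms send at most two vertices of `G` to
prescribed vertices of `H` and all the others to a fixed looped vertex that is joined in both
directions to the prescribed ones. In `G₁` the loopless vertex `0` detects missing loops (the other
vertices go to `1`) and the non-edge `2 ≁ 1` detects missing edges (the other vertices go to `3`);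
in `S₁` these roles are played by `0`, `1` and by `1 ≁ 3`, `2`; in `R₁` only `1 ≁ 0`, `2` is needed.
-/

namespace AdjSemigroup

open UnarySemigroup

universe w x

section Division

variable {X : Type u} {Y : Type v} {Z : Type w}
  [UnarySemigroup X] [UnarySemigroup Y] [UnarySemigroup Z]

/-- A relation exhibiting `Y` as a homomorphic image of a subalgebra of `X`: the subalgebra is the
domain of `R`, and `R` is the graph of the homomorphism. -/
structure IsDivision (R : X → Y → Prop) : Prop where
  mul : ∀ {a a' b b'}, R a b → R a' b' → R (a * a') (b * b')
  rev : ∀ {a b}, R a b → R (rev a) (rev b)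
  rightUnique : Relator.RightUnique R
  rightTotal : Relator.RightTotal R

theorem IsUnaryHom.isDivision_of_surjective {f : X → Y} (hf : IsUnaryHom f)
    (hsurj : Function.Surjective f) : IsDivision fun a b => f a = b where
  mul := by rintro a a' _ _ rfl rfl; exact hf.map_mul a a'
  rev := by rintro a _ rfl; exact hf.map_rev a
  rightUnique _ _ _ h h' := h.symm.trans h'
  rightTotal := hsurj

theorem IsUnaryHom.isDivision_of_injective {f : Y → X} (hf : IsUnaryHom f)
    (hinj : Function.Injective f) : IsDivision fun a b => f b = a where
  mul := by rintro _ _ b b' rfl rfl; exact hf.map_mul b b'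
  rev := by rintro _ b rfl; exact hf.map_rev b
  rightUnique _ _ _ h h' := hinj (h.trans h'.symm)
  rightTotal b := ⟨f b, rfl⟩

namespace IsDivision

theorem comp {R : X → Y → Prop} {Q : Y → Z → Prop} (hR : IsDivision R) (hQ : IsDivision Q) :
    IsDivision (Relation.Comp R Q) where
  mul := fun ⟨b, hab, hbc⟩ ⟨b', hab', hbc'⟩ => ⟨b * b', hR.mul hab hab', hQ.mul hbc hbc'⟩
  rev := fun ⟨b, hab, hbc⟩ => ⟨UnarySemigroup.rev b, hR.rev hab, hQ.rev hbc⟩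
  rightUnique := by
    rintro _ _ _ ⟨b, hab, hbc⟩ ⟨b', hab', hbc'⟩
    obtain rfl := hR.rightUnique hab hab'
    exact hQ.rightUnique hbc hbc'
  rightTotal c :=
    let ⟨b, hbc⟩ := hQ.rightTotal c
    let ⟨a, hab⟩ := hR.rightTotal b
    ⟨a, b, hab, hbc⟩

theorem pi {ι : Type x} {S : ι → Type u} {T : ι → Type v} [∀ i, UnarySemigroup (S i)]
    [∀ i, UnarySemigroup (T i)] {R : ∀ i, S i → T i → Prop} (hR : ∀ i, IsDivision (R i)) :
    IsDivision fun (a : ∀ i, S i) (b : ∀ i, T i) => ∀ i, R i (a i) (b i) where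
  mul h h' i := (hR i).mul (h i) (h' i)
  rev h i := (hR i).rev (h i)
  rightUnique _ _ _ h h' := funext fun i => (hR i).rightUnique (h i) (h' i)
  rightTotal b := Classical.skolem.1 fun i => (hR i).rightTotal (b i)

/-- The domain of a division, as a subalgebra of its source. -/
abbrev domain {R : X → Y → Prop} (hR : IsDivision R) : UnarySemigroup {a // ∃ b, R a b} where
  mul a a' := ⟨a.1 * a'.1, a.2.elim fun _ h => a'.2.elim fun _ h' => ⟨_, hR.mul h h'⟩⟩
  mul_assoc a b c := Subtype.ext (mul_assoc a.1 b.1 c.1)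
  rev a := ⟨UnarySemigroup.rev a.1, a.2.elim fun _ h => ⟨_, hR.rev h⟩⟩

end IsDivision

end Division

theorem mem_opH_opS_iff {K : Set USgrp.{u}} {T : USgrp.{u}} :
    T ∈ opH (opS K) ↔ ∃ S ∈ K, ∃ R : S.carrier → T.carrier → Prop, IsDivision R := by
  constructor
  · rintro ⟨U, ⟨S, hS, g, hg, hg_inj⟩, f, hf, hf_surj⟩
    exact ⟨S, hS, _, (hg.isDivision_of_injective hg_inj).comp (hf.isDivision_of_surjective hf_surj)⟩
  · rintro ⟨S, hS, R, hR⟩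
    let := hR.domain
    have : Nonempty {a // ∃ b, R a b} :=
      let ⟨t⟩ := T.nonempty
      let ⟨a, ha⟩ := hR.rightTotal t
      ⟨⟨a, t, ha⟩⟩
    choose f hf using fun a : {a // ∃ b, R a b} => a.2
    refine ⟨⟨{a // ∃ b, R a b}⟩, ⟨S, hS, Subtype.val, ⟨fun _ _ => rfl, fun _ => rfl⟩,
      Subtype.val_injective⟩, f, ⟨fun a b => ?_, fun a => ?_⟩, fun t => ?_⟩
    · exact hR.rightUnique (hf (a * b)) (hR.mul (hf a) (hf b))
    · exact hR.rightUnique (hf (rev a)) (hR.rev (hf a))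
    · obtain ⟨a, ha⟩ := hR.rightTotal t
      exact ⟨⟨a, t, ha⟩, hR.rightUnique (hf _) ha⟩

/-- `T` is a homomorphic image of a subalgebra of a product, indexed by a type in universe `v`, of
members of `K`. By `mem_HSP_iff` this is membership in `HSP K`, except that `T` may live in any
universe. -/
def DividesProduct (K : Set USgrp.{u}) (T : Type w) [UnarySemigroup T] : Prop :=
  ∃ (ι : Type v) (S : ι → USgrp.{u}), (∀ i, S i ∈ K) ∧
    ∃ R : (∀ i, (S i).carrier) → T → Prop, IsDivision R

theorem mem_HSP_iff {K : Set USgrp.{u}} {T : USgrp.{max u v}} :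
    T ∈ HSP.{u, v} K ↔ DividesProduct.{u, v} K T.carrier := by
  refine mem_opH_opS_iff.trans ⟨?_, ?_⟩
  · rintro ⟨P, ⟨ι, S, hS, e, he, he_bij⟩, R, hR⟩
    exact ⟨ι, S, hS, _, (he.isDivision_of_injective he_bij.injective).comp hR⟩
  · rintro ⟨ι, S, hS, R, hR⟩
    exact ⟨USgrp.pi S, ⟨ι, S, hS, id, ⟨fun _ _ => rfl, fun _ => rfl⟩, Function.bijective_id⟩, R, hR⟩

theorem DividesProduct.trans {K : Set USgrp.{u}} {K' : Set USgrp.{x}} {T : Type w}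
    [UnarySemigroup T] (hT : DividesProduct.{u, v} K T)
    (hK : ∀ S ∈ K, DividesProduct.{x, v} K' S.carrier) : DividesProduct.{x, v} K' T := by
  obtain ⟨ι, S, hS, R, hR⟩ := hT
  choose κ S' hS' Q hQ using fun i => hK (S i) (hS i)
  have hcurry : IsUnaryHom (Sigma.curry (α := ι) (β := κ) (γ := fun i j => (S' i j).carrier)) :=
    ⟨fun _ _ => rfl, fun _ => rfl⟩
  exact ⟨Σ i, κ i, fun p => S' p.1 p.2, fun p => hS' p.1 p.2, _,
    ((hcurry.isDivision_of_surjective (Equiv.piCurry _).surjective).comp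
      (IsDivision.pi hQ)).comp hR⟩

/-- The direct product of a family of digraphs, with coordinatewise adjacency. -/
def piDigraph {ι : Type v} {W : ι → Type u} (H : ∀ i, Digraph (W i)) : Digraph (∀ i, W i) where
  Adj x y := ∀ i, (H i).Adj (x i) (y i)

namespace Carrier

theorem zero_mul {V : Type u} {G : Digraph V} (a : Carrier G) : zero * a = zero := rfl

theorem mul_zero {V : Type u} {G : Digraph V} (a : Carrier G) : a * zero = zero := by
  cases a <;> rfl

theorem pair_mul_of_adj {V : Type u} {G : Digraph V} {x y z t : V} (h : G.Adj y z) :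
    (pair x y * pair z t : Carrier G) = pair x t := if_pos h

theorem pair_mul_of_not_adj {V : Type u} {G : Digraph V} {x y z t : V} (h : ¬ G.Adj y z) :
    (pair x y * pair z t : Carrier G) = zero := if_neg h

section Map

variable {V : Type u} {W : Type v} {G : Digraph V} {H : Digraph W}

/-- The map `A(G) → A(H)` induced by a map of vertices. -/
def map (f : V → W) : Carrier G → Carrier H
  | zero => zero
  | pair x y => pair (f x) (f y)

theorem map_injective {f : V → W} (hf : Function.Injective f) :
    Function.Injective (map f : Carrier G → Carrier H) := by
  rintro (_ | ⟨x, y⟩) (_ | ⟨z, t⟩) h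
  · rfl
  · cases h
  · cases h
  · obtain ⟨hxz, hyt⟩ := pair.inj h
    rw [hf hxz, hf hyt]

theorem isUnaryHom_map (e : G.Adj ↪r H.Adj) : IsUnaryHom (map e : Carrier G → Carrier H) where
  map_mul := by
    rintro (_ | ⟨x, y⟩) (_ | ⟨z, t⟩)
    · rfl
    · rfl
    · rfl
    · by_cases h : G.Adj y z
      · rw [pair_mul_of_adj h]
        exact (pair_mul_of_adj (e.map_rel_iff.2 h)).symm
      · rw [pair_mul_of_not_adj h]
        exact (pair_mul_of_not_adj (mt e.map_rel_iff.1 h)).symm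
  map_rev := by rintro (_ | _) <;> rfl

end Map

section Collapse

variable {ι : Type v} {W : ι → Type u} {H : ∀ i, Digraph (W i)}

theorem exists_eq_zero_or_eq_pair (a : ∀ i, Carrier (H i)) :
    (∃ i, a i = zero) ∨ ∃ x y : ∀ i, W i, a = fun i => pair (x i) (y i) := by
  refine or_iff_not_imp_left.2 fun hne => ?_
  have hpair : ∀ i, ∃ x y, a i = pair x y := fun i => by
    cases h : a i with
    | zero => exact absurd ⟨i, h⟩ hne
    | pair x y => exact ⟨x, y, rfl⟩
  choose x y hxy using hpair
  exact ⟨x, y, funext hxy⟩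

open Classical in
/-- The quotient map of a product of adjacency semigroups by the ideal of all tuples with a zero
coordinate; the Rees quotient is the adjacency semigroup of the product digraph. -/
noncomputable def collapse (a : ∀ i, Carrier (H i)) : Carrier (piDigraph H) :=
  if h : ∃ x y : ∀ i, W i, a = fun i => pair (x i) (y i) then pair h.choose h.choose_spec.choose
  else zero

theorem collapse_pair (x y : ∀ i, W i) :
    collapse (fun i => (pair (x i) (y i) : Carrier (H i))) = pair x y := by
  have h : ∃ x' y' : ∀ i, W i, (fun i => (pair (x i) (y i) : Carrier (H i))) =
      fun i => pair (x' i) (y' i) := ⟨x, y, rfl⟩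
  have hxy := fun i => pair.inj (congrFun h.choose_spec.choose_spec i)
  exact (dif_pos h).trans
    (congrArg₂ pair (funext fun i => (hxy i).1.symm) (funext fun i => (hxy i).2.symm))

theorem collapse_of_eq_zero {a : ∀ i, Carrier (H i)} {i : ι} (h : a i = zero) :
    collapse a = zero := by
  refine dif_neg ?_
  rintro ⟨x, y, rfl⟩
  cases h

theorem isUnaryHom_collapse :
    IsUnaryHom (collapse : (∀ i, Carrier (H i)) → Carrier (piDigraph H)) where
  map_mul a b := by
    obtain ⟨i, hi⟩ | ⟨x, y, rfl⟩ := exists_eq_zero_or_eq_pair a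
    · rw [collapse_of_eq_zero hi, zero_mul]
      exact collapse_of_eq_zero ((congrArg (· * b i) hi).trans (zero_mul _))
    obtain ⟨i, hi⟩ | ⟨z, t, rfl⟩ := exists_eq_zero_or_eq_pair b
    · rw [collapse_of_eq_zero hi, mul_zero]
      exact collapse_of_eq_zero ((congrArg (pair (x i) (y i) * ·) hi).trans (mul_zero _))
    rw [collapse_pair, collapse_pair]
    by_cases h : ∀ i, (H i).Adj (y i) (z i)
    · rw [pair_mul_of_adj h, ← collapse_pair]
      exact congrArg collapse (funext fun i => pair_mul_of_adj (h i))
    · rw [pair_mul_of_not_adj h]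
      obtain ⟨i, hi⟩ := not_forall.1 h
      exact collapse_of_eq_zero (i := i) (pair_mul_of_not_adj hi)
  map_rev a := by
    obtain ⟨i, hi⟩ | ⟨x, y, rfl⟩ := exists_eq_zero_or_eq_pair a
    · rw [collapse_of_eq_zero hi]
      exact collapse_of_eq_zero (congrArg Carrier.rev hi)
    · rw [collapse_pair]
      exact collapse_pair y x

theorem collapse_surjective [Nonempty ι] :
    Function.Surjective (collapse : (∀ i, Carrier (H i)) → Carrier (piDigraph H))
  | zero => ⟨fun _ => zero, collapse_of_eq_zero (i := Classical.arbitrary ι) rfl⟩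
  | pair x y => ⟨_, collapse_pair x y⟩

end Collapse

/-- Elements of `A(G)` as ordered pairs of vertices with a bottom element adjoined. -/
def equivOption {V : Type u} (G : Digraph V) : Carrier G ≃ Option (V × V) where
  toFun
    | zero => none
    | pair x y => some (x, y)
  invFun
    | none => zero
    | some (x, y) => pair x y
  left_inv := by rintro (_ | _) <;> rfl
  right_inv := by rintro (_ | _) <;> rfl

end Carrier

theorem card_A {V : Type u} [Finite V] (G : Digraph V) :
    Nat.card (A G).carrier = Nat.card V ^ 2 + 1 :=
  (Nat.card_congr (Carrier.equivOption G)).trans (by rw [Finite.card_option, Nat.card_prod, sq])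

theorem dividesProduct_A {ι : Type v} [Nonempty ι] {W : ι → Type u} {H : ∀ i, Digraph (W i)}
    {K : Set USgrp.{u}} (hK : ∀ i, A (H i) ∈ K) {V : Type w} {G : Digraph V}
    (e : G.Adj ↪r (piDigraph H).Adj) : DividesProduct.{u, v} K (A G).carrier :=
  ⟨ι, fun i => A (H i), hK, _,
    (Carrier.isUnaryHom_collapse.isDivision_of_surjective Carrier.collapse_surjective).comp
      ((Carrier.isUnaryHom_map e).isDivision_of_injective (Carrier.map_injective e.injective))⟩

section Homs

variable {V : Type u} {W : Type v} {G : Digraph V} {H : Digraph W}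

/-- The homomorphisms from `G` to `H` separate the vertices and the non-edges of `G`; equivalently,
`G` is an induced subgraph of a nonempty power of `H`. -/
structure HomsSeparate (G : Digraph V) (H : Digraph W) : Prop where
  nonempty : Nonempty (G.Adj →r H.Adj)
  exists_ne : ∀ {u v}, u ≠ v → ∃ φ : G.Adj →r H.Adj, φ u ≠ φ v
  exists_not_adj : ∀ {u v}, ¬ G.Adj u v → ∃ φ : G.Adj →r H.Adj, ¬ H.Adj (φ u) (φ v)

/-- The evaluation map into the power of `H` indexed by the homomorphisms from `G` to `H`. -/
def HomsSeparate.embedding (h : HomsSeparate G H) :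
    G.Adj ↪r (piDigraph fun _ : G.Adj →r H.Adj => H).Adj where
  toFun x φ := φ x
  inj' x y hxy := by
    by_contra hne
    obtain ⟨φ, hφ⟩ := h.exists_ne hne
    exact hφ (congrFun hxy φ)
  map_rel_iff' := by
    refine ⟨fun hadj => ?_, fun hadj φ => φ.map_rel hadj⟩
    by_contra hnadj
    obtain ⟨φ, hφ⟩ := h.exists_not_adj hnadj
    exact hφ (hadj φ)

theorem HomsSeparate.dividesProduct (h : HomsSeparate G H) :
    DividesProduct.{v, max u v} {A H} (A G).carrier :=
  have := h.nonempty
  dividesProduct_A (fun _ => Set.mem_singleton _) h.embedding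

open Classical in
/-- The homomorphism that agrees with `φ` except that it sends `u` to `a`. -/
noncomputable def updateHom (φ : G.Adj →r H.Adj) (u : V) (a : W) (hloop : G.Adj u u → H.Adj a a)
    (hout : ∀ x ≠ u, G.Adj u x → H.Adj a (φ x)) (hin : ∀ x ≠ u, G.Adj x u → H.Adj (φ x) a) :
    G.Adj →r H.Adj where
  toFun := Function.update φ u a
  map_rel' {x y} hxy := by
    obtain rfl | hx := eq_or_ne x u
    · obtain rfl | hy := eq_or_ne y x
      · simpa only [Function.update_self] using hloop hxy
      · simpa only [Function.update_self, Function.update_of_ne hy] using hout y hy hxy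
    · obtain rfl | hy := eq_or_ne y u
      · simpa only [Function.update_self, Function.update_of_ne hx] using hin x hx hxy
      · simpa only [Function.update_of_ne hx, Function.update_of_ne hy] using φ.map_rel hxy

theorem updateHom_self (φ : G.Adj →r H.Adj) {u : V} {a : W} (hloop : G.Adj u u → H.Adj a a)
    (hout : ∀ x ≠ u, G.Adj u x → H.Adj a (φ x)) (hin : ∀ x ≠ u, G.Adj x u → H.Adj (φ x) a) :
    updateHom φ u a hloop hout hin u = a := by
  classical exact Function.update_self u a φ

theorem updateHom_of_ne (φ : G.Adj →r H.Adj) {u : V} {a : W} (hloop : G.Adj u u → H.Adj a a)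
    (hout : ∀ x ≠ u, G.Adj u x → H.Adj a (φ x)) (hin : ∀ x ≠ u, G.Adj x u → H.Adj (φ x) a)
    {x : V} (hx : x ≠ u) : updateHom φ u a hloop hout hin x = φ x := by
  classical exact Function.update_of_ne hx a φ

theorem exists_hom_of_vertex {a c : W} (hcc : H.Adj c c) (hac : H.Adj a c ∧ H.Adj c a)
    {u : V} (haa : G.Adj u u → H.Adj a a) :
    ∃ φ : G.Adj →r H.Adj, φ u = a ∧ ∀ x ≠ u, φ x = c :=
  ⟨updateHom ⟨fun _ => c, fun _ => hcc⟩ u a haa (fun _ _ _ => hac.1) (fun _ _ _ => hac.2),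
    updateHom_self .., fun _ hx => updateHom_of_ne _ _ _ _ hx⟩

theorem exists_hom_of_pair {a b c : W} (hcc : H.Adj c c) (hac : H.Adj a c ∧ H.Adj c a)
    (hbc : H.Adj b c ∧ H.Adj c b) {u v : V} (huv : u ≠ v) (haa : G.Adj u u → H.Adj a a)
    (hbb : G.Adj v v → H.Adj b b) (hab : G.Adj u v → H.Adj a b) (hba : G.Adj v u → H.Adj b a) :
    ∃ φ : G.Adj →r H.Adj, φ u = a ∧ φ v = b := by
  obtain ⟨φ, hφv, hφ⟩ := exists_hom_of_vertex hcc hbc hbb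
  refine ⟨updateHom φ u a haa (fun x _ hux => ?_) (fun x _ hxu => ?_),
    updateHom_self .., (updateHom_of_ne _ _ _ _ huv.symm).trans hφv⟩
  · obtain rfl | hx := eq_or_ne x v
    · exact hφv ▸ hab hux
    · exact hφ x hx ▸ hac.1
  · obtain rfl | hx := eq_or_ne x v
    · exact hφv ▸ hba hxu
    · exact hφ x hx ▸ hac.2

theorem exists_hom_ne {a c : W} (hne : a ≠ c) (haa : H.Adj a a) (hcc : H.Adj c c)
    (hac : H.Adj a c ∧ H.Adj c a) {u v : V} (huv : u ≠ v) :
    ∃ φ : G.Adj →r H.Adj, φ u ≠ φ v := by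
  obtain ⟨φ, hu, hφ⟩ := exists_hom_of_vertex (G := G) (u := u) hcc hac fun _ => haa
  exact ⟨φ, by rwa [hu, hφ v huv.symm]⟩

theorem exists_hom_not_adj_self {a c : W} (haa : ¬ H.Adj a a) (hcc : H.Adj c c)
    (hac : H.Adj a c ∧ H.Adj c a) {u : V} (hu : ¬ G.Adj u u) :
    ∃ φ : G.Adj →r H.Adj, ¬ H.Adj (φ u) (φ u) := by
  obtain ⟨φ, hφu, -⟩ := exists_hom_of_vertex hcc hac (absurd · hu)
  exact ⟨φ, by rwa [hφu]⟩

end Homs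

/-- A copy of the digraph `H` in a higher universe. -/
def uliftDigraph {W : Type v} (H : Digraph W) : Digraph (ULift.{u} W) where
  Adj := Equiv.ulift ⁻¹'o H.Adj

theorem dividesProduct_of_uliftDigraph {W : Type v} {H : Digraph W} {K : Set USgrp.{max u v}}
    (hK : A (uliftDigraph.{u} H) ∈ K) : DividesProduct.{max u v, w} K (A H).carrier :=
  let e : H.Adj ↪r (piDigraph fun _ : PUnit.{w + 1} => uliftDigraph.{u} H).Adj :=
    ⟨⟨fun x _ => ⟨x⟩, fun _ _ h => congrArg ULift.down (congrFun h ⟨⟩)⟩,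
      ⟨fun h => h ⟨⟩, fun h _ => h⟩⟩
  dividesProduct_A (fun _ => hK) e

theorem HSP_setOf_A_eq {W : Type v} (H : Digraph W)
    (P : ∀ {V : Type max u v}, Digraph V → Prop) (hH : P (uliftDigraph.{u} H))
    (hP : ∀ {V : Type max u v} {G : Digraph V}, P G → HomsSeparate G H) :
    HSP.{max u v, max u v} {S | ∃ (V : Type max u v) (G : Digraph V), P G ∧ S = A G} =
      HSP.{v, max u v} {A H} := by
  ext T
  rw [mem_HSP_iff.{max u v, max u v}, mem_HSP_iff.{v, max u v}]
  constructor <;> intro hT <;> refine hT.trans ?_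
  · rintro _ ⟨V, G, hG, rfl⟩
    exact (hP hG).dividesProduct
  · rintro _ rfl
    exact dividesProduct_of_uliftDigraph ⟨_, _, hH, rfl⟩

instance : DecidableRel G₁.Adj := fun _ _ => inferInstanceAs (Decidable (_ ∈ _))
instance : DecidableRel S₁.Adj := fun _ _ => inferInstanceAs (Decidable (_ ∈ _))
instance : DecidableRel R₁.Adj := fun _ _ => inferInstanceAs (Decidable (_ ∈ _))

theorem homsSeparate_G₁ {V : Type u} (G : Digraph V) : HomsSeparate G G₁ where
  nonempty := ⟨⟨fun _ => 1, fun _ => by decide⟩⟩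
  exists_ne := exists_hom_ne (a := 1) (c := 3) (by decide) (by decide) (by decide) (by decide)
  exists_not_adj {u v} huv := by
    obtain rfl | hne := eq_or_ne u v
    · exact exists_hom_not_adj_self (a := 0) (c := 1) (by decide) (by decide) (by decide) huv
    · obtain ⟨φ, hu, hv⟩ := exists_hom_of_pair (G := G) (H := G₁) (a := 2) (b := 1) (c := 3)
        (by decide) (by decide) (by decide) hne (fun _ => by decide) (fun _ => by decide)
        (absurd · huv) (fun _ => by decide)
      exact ⟨φ, by rw [hu, hv]; decide⟩

theorem homsSeparate_S₁ {V : Type u} {G : Digraph V} (hG : ∀ x y, G.Adj x y → G.Adj y x) :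
    HomsSeparate G S₁ where
  nonempty := ⟨⟨fun _ => 1, fun _ => by decide⟩⟩
  exists_ne := exists_hom_ne (a := 1) (c := 2) (by decide) (by decide) (by decide) (by decide)
  exists_not_adj {u v} huv := by
    obtain rfl | hne := eq_or_ne u v
    · exact exists_hom_not_adj_self (a := 0) (c := 1) (by decide) (by decide) (by decide) huv
    · obtain ⟨φ, hu, hv⟩ := exists_hom_of_pair (G := G) (H := S₁) (a := 1) (b := 3) (c := 2)
        (by decide) (by decide) (by decide) hne (fun _ => by decide) (fun _ => by decide)
        (absurd · huv) (fun hvu => absurd (hG v u hvu) huv)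
      exact ⟨φ, by rw [hu, hv]; decide⟩

theorem homsSeparate_R₁ {V : Type u} {G : Digraph V} (hG : ∀ x, G.Adj x x) :
    HomsSeparate G R₁ where
  nonempty := ⟨⟨fun _ => 0, fun _ => by decide⟩⟩
  exists_ne := exists_hom_ne (a := 0) (c := 2) (by decide) (by decide) (by decide) (by decide)
  exists_not_adj {u v} huv := by
    have hne : u ≠ v := fun h => huv (h ▸ hG u)
    obtain ⟨φ, hu, hv⟩ := exists_hom_of_pair (G := G) (H := R₁) (a := 1) (b := 0) (c := 2)
      (by decide) (by decide) (by decide) hne (fun _ => by decide) (fun _ => by decide)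
      (absurd · huv) (fun _ => by decide)
    exact ⟨φ, by rw [hu, hv]; decide⟩

end AdjSemigroup

theorem proposition5p1 :
    (AdjSemigroup.varA.{u} = AdjSemigroup.HSP.{0, u} {AdjSemigroup.A AdjSemigroup.G₁} ∧
      Nat.card (AdjSemigroup.A AdjSemigroup.G₁).carrier = 17) ∧
    (AdjSemigroup.varAsymm.{u} = AdjSemigroup.HSP.{0, u} {AdjSemigroup.A AdjSemigroup.S₁} ∧
      Nat.card (AdjSemigroup.A AdjSemigroup.S₁).carrier = 17) ∧
    (AdjSemigroup.varAref.{u} = AdjSemigroup.HSP.{0, u} {AdjSemigroup.A AdjSemigroup.R₁} ∧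
      Nat.card (AdjSemigroup.A AdjSemigroup.R₁).carrier = 10) := by
  open AdjSemigroup in
  have hS : ∀ x y, S₁.Adj x y → S₁.Adj y x := by decide
  have hR : ∀ x, R₁.Adj x x := by decide
  refine ⟨⟨?_, by simp [card_A]⟩, ⟨?_, by simp [card_A]⟩, ⟨?_, by simp [card_A]⟩⟩
  · simpa only [varA, true_and] using
      HSP_setOf_A_eq.{u, 0} G₁ (fun _ => True) trivial fun _ => homsSeparate_G₁ _
  · exact HSP_setOf_A_eq.{u, 0} S₁ (fun G => ∀ x y, G.Adj x y → G.Adj y x)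
      (fun x y => hS x.down y.down) homsSeparate_S₁
  · exact HSP_setOf_A_eq.{u, 0} R₁ (fun G => ∀ x, G.Adj x x) (fun x => hR x.down) homsSeparate_R₁
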